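/- Let $\alpha\in(0,1]$, let $(X,d_X)$ be a metric space, and let $f:\mathbb R\to X$ be everywhere locally $\alpha$-Hölder regular, i.e. for every $t\in\mathbb R$ the number $\alpha$ is the supremum of all $\beta\in(0,1]$ for which there are a neighbourhood $U$ of $t$ and a constant $C>0$ with $d_X(f(t),f(u))\le C|t-u|^{\beta}$ for all $u\in U$. Equip the graph $\operatorname{gr}(f)=\{(t,f(t)):t\in\mathbb R\}$ with the maximum metric $d_\infty((t,y),(t',y'))=|t-t'|\vee d_X(y,y')$ and with the image measure $\varphi_*\lambda^1$ of Lebesgue measure under $\varphi:\mathbb R\to\operatorname{gr}(f)$, $\varphi(t)=(t,f(t))$. For $t\in\mathbb R$ let $(W^t_s)_{s\ge0}$ be a one-dimensional Wiener process started in $t$, so that $\varphi(W^t)$ is a process on $\operatorname{gr}(f)$ started in $\varphi(t)$. For $x=\varphi(t)$ and $r>0$ let $\tau_x(r)=\inf\{s\ge 0: d_\infty(\varphi(W^t_s),x)\ge r\}$ be its first exit time from the open ball of radius $r$ around $x$, and let the upper local walk dimension at $x$ be \[ \overline{\dim}_W(\operatorname{gr}(f),\varphi(W);x)=\limsup_{r\searrow0}\frac{\log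 \mathbb E[\tau_x(r)]}{\log r}. \] Then the upper walk dimension $\overline{\dim}_W(\operatorname{gr}(f),\varphi(W))$, i.e. the $\varphi_*\lambda^1$-almost everywhere constant value of the upper local walk dimension, exists and equals $2/\alpha$: for $\varphi_*\lambda^1$-almost every $x\in\operatorname{gr}(f)$, \[ \overline{\dim}_W(\operatorname{gr}(f),\varphi(W);x)=\frac{2}{\alpha}. \] -/

import Mathlib

open MeasureTheory ProbabilityTheory Filter Topology
open scoped NNReal ENNReal

section Holder

variable {X Y : Type*} [MetricSpace X] [MetricSpace Y]

/-- `φ` is locally `β`-Hölder continuous at the point `x`. -/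
def LocallyHolderAt (β : ℝ) (φ : X → Y) (x : X) : Prop :=
  ∃ U : Set X, IsOpen U ∧ x ∈ U ∧ ∃ C : ℝ, 0 < C ∧ ∀ y ∈ U, dist (φ x) (φ y) ≤ C * dist x y ^ β

/-- `φ` is locally `α`-Hölder regular at `x`: `α` is the supremum of all Hölder exponents
`β ∈ (0, 1]` for which `φ` is locally `β`-Hölder continuous at `x`. -/
def LocallyHolderRegularAt (α : ℝ) (φ : X → Y) (x : X) : Prop :=
  IsLUB {β : ℝ | β ∈ Set.Ioc (0 : ℝ) 1 ∧ LocallyHolderAt β φ x} α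

end Holder

section WalkDimension

variable {Ω Y : Type*} [MetricSpace Y]

/-- First exit time of the process `M` from the open ball `B(y, r)`; it is `∞` on the paths that
never leave the ball. -/
noncomputable def exitTime (M : ℝ≥0 → Ω → Y) (y : Y) (r : ℝ) (ω : Ω) : ℝ≥0∞ :=
  ⨅ (s : ℝ≥0) (_ : M s ω ∉ Metric.ball y r), (s : ℝ≥0∞)

variable [MeasurableSpace Ω]

/-- Upper local walk dimension at `y` of the process `M`, where `M` starts in `y` under `P`:
`limsup_{r ↘ 0} log E[τ(B(y, r))] / log r`. -/
noncomputable def upperLocalWalkDim (P : Measure Ω) (M : ℝ≥0 → Ω → Y) (y : Y) : EReal :=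
  limsup (fun r : ℝ => ENNReal.log (∫⁻ ω, exitTime M y r ω ∂P) / ((Real.log r : ℝ) : EReal))
    (𝓝[>] (0 : ℝ))

/-- The upper walk dimension of a metric measure space `(Y, μ)` with respect to a process is `d`.
The process is given by one process `M y`, under the law `P y`, for every starting point `y`; the
upper local walk dimension has to be `μ`-almost everywhere constant, with value `d`. -/
def HasUpperWalkDim [MeasurableSpace Y] (μ : Measure Y) (P : Y → Measure Ω)
    (M : Y → ℝ≥0 → Ω → Y) (d : EReal) : Prop :=
  ∀ᵐ y ∂μ, upperLocalWalkDim (P y) (M y) y = d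

end WalkDimension

section Graph

variable {X Y : Type*} [MetricSpace X] [MetricSpace Y]

/-- The graph of `f`, with the restriction of the maximum metric on `X × Y`. -/
def FunGraph (f : X → Y) : Type _ := {p : X × Y // p.2 = f p.1}

instance (f : X → Y) : MetricSpace (FunGraph f) :=
  inferInstanceAs (MetricSpace {p : X × Y // p.2 = f p.1})

instance (f : X → Y) : MeasurableSpace (FunGraph f) := borel _

instance (f : X → Y) : BorelSpace (FunGraph f) := ⟨rfl⟩

/-- The natural map `x ↦ (x, f x)` onto the graph. -/
def toFunGraph (f : X → Y) (x : X) : FunGraph f := ⟨(x, f x), rfl⟩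

/-- The projection of the graph onto the first coordinate. -/
def FunGraph.proj {f : X → Y} (p : FunGraph f) : X := p.1.1

/-- The image of Lebesgue measure on the graph of a function of a real variable. -/
noncomputable def funGraphMeasure (f : ℝ → Y) : Measure (FunGraph f) :=
  Measure.map (toFunGraph f) volume

end Graph

/-- `W` is, under `P`, a Wiener process (one-dimensional Brownian motion) started in `t`. -/
def IsWienerFrom {Ω : Type*} [MeasurableSpace Ω] (t : ℝ) (W : ℝ≥0 → Ω → ℝ) (P : Measure Ω) :
    Prop :=
  IsBrownianReal (fun s ω => W s ω - t) P

/-! ### Exit times of Brownian motion at unit scale. -/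

section BrownianExit

variable {Ω : Type*} {mΩ : MeasurableSpace Ω} {B : ℝ≥0 → Ω → ℝ} {P : Measure Ω}

/-! By Brownian scaling, leaving an interval of radius `h` takes expected time of order `h ^ 2`, so
the question is how far from `t` the graph first leaves the ball of radius `r`. Since `log r < 0`,
lower bounds on the expectation bound the dimension from above, and conversely.

Upper bound, at every point: Hölder exponents near `α` keep the graph in the ball up to distance `r
^ e`, for any `e > 1 / α` and small `r` (`exists_le_lintegral_exitTime`, `upperLocalWalkDim_le`).

Lower bound, almost everywhere: for `b' > 1 / α` nothing is needed, while for `1 < b' < 1 / α`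
failure of `1 / b'`-Hölder continuity makes `f` move by more than `r` within `r ^ b'` of `t`, for
arbitrarily small `r`, but perhaps on one side only, and the motion could escape to the other side.
Points with a large move on one side and a quiet stretch of length `r ^ b`, `b < b'`, on the other
are rare: they have measure of order `r ^ (b' - b)` in a bounded window. Borel–Cantelli
(`ae_eventually_notMem_oneSidedJumpSet`) excludes them, so exits exist within `r ^ b` on both sides
(`frequently_exists_two_sided`), and `lintegral_exitTime_le` applies. -/

lemma gaussianReal_Icc_lt_one : gaussianReal 0 1 (Set.Icc (-2) 2) < 1 := by
  have h : gaussianReal 0 1 (Set.Icc (-2) 2)ᶜ ≠ 0 := by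
    intro h0
    have h1 := gaussianReal_absolutelyContinuous' 0 (v := 1) one_ne_zero h0
    have h2 : volume (Set.Ioo (3 : ℝ) 4) ≤ volume (Set.Icc (-2 : ℝ) 2)ᶜ := by
      refine measure_mono fun x hx hx' => ?_
      linarith [hx.1, hx'.2]
    rw [h1, Real.volume_Ioo] at h2
    norm_num at h2
  have h1 := prob_add_prob_compl (μ := gaussianReal 0 1) (measurableSet_Icc (a := (-2 : ℝ)) (b := 2))
  by_contra! hle
  have h2 : gaussianReal 0 1 (Set.Icc (-2) 2) = 1 := le_antisymm prob_le_one hle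
  rw [h2] at h1
  exact h (by simpa using h1)

/-- A universal bound for the expected exit time of a Brownian motion from `[-1, 1]`. -/
noncomputable def exitBound : ℝ≥0∞ := (1 - gaussianReal 0 1 (Set.Icc (-2) 2))⁻¹

lemma exitBound_ne_top : exitBound ≠ ∞ :=
  ENNReal.inv_ne_top.2 (tsub_pos_of_lt gaussianReal_Icc_lt_one).ne'

lemma exitBound_ne_zero : exitBound ≠ 0 :=
  ENNReal.inv_ne_zero.2 (ENNReal.sub_ne_top ENNReal.one_ne_top)

lemma measure_forall_increment_mem (hB : IsPreBrownianReal B P) (k : ℕ) :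
    P {ω | ∀ j < k, B ((j : ℝ≥0) + 1) ω - B j ω ∈ Set.Icc (-2 : ℝ) 2} =
      gaussianReal 0 1 (Set.Icc (-2) 2) ^ k := by
  have hind := hB.hasIndepIncrements.nat (t := fun n : ℕ => (n : ℝ≥0)) Nat.mono_cast
  have h := hind.measure_inter_preimage_eq_mul (Finset.range k)
    (sets := fun _ => Set.Icc (-2 : ℝ) 2) (fun _ _ => measurableSet_Icc)
  have hset : {ω | ∀ j < k, B ((j : ℝ≥0) + 1) ω - B j ω ∈ Set.Icc (-2 : ℝ) 2} =
      ⋂ i ∈ Finset.range k, (fun ω => B ((i + 1 : ℕ) : ℝ≥0) ω - B (i : ℝ≥0) ω) ⁻¹'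
        Set.Icc (-2 : ℝ) 2 := by
    ext ω; simp
  rw [hset, h, Finset.prod_eq_pow_card (b := gaussianReal 0 1 (Set.Icc (-2) 2)), Finset.card_range]
  intro i _
  have hl := hB.hasLaw_sub ((i + 1 : ℕ) : ℝ≥0) (i : ℝ≥0)
  have h1 : nndist ((i + 1 : ℕ) : ℝ≥0).1 (i : ℝ≥0).1 = 1 := by
    change nndist (((i + 1 : ℕ) : ℝ≥0) : ℝ) ((i : ℝ≥0) : ℝ) = 1
    ext
    simp
  rw [h1] at hl
  exact hl.measure_eq (p := fun x => x ∈ Set.Icc (-2 : ℝ) 2) measurableSet_Icc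

/-- The expectation of any random time dominated by the integer times at which the Brownian
motion lies outside `[-1, 1]` is at most `exitBound`. -/
lemma lintegral_le_exitBound (hB : IsPreBrownianReal B P) {T : Ω → ℝ≥0∞}
    (hT : ∀ᵐ ω ∂P, ∀ n : ℕ, 1 < |B n ω| → T ω ≤ n) : ∫⁻ ω, T ω ∂P ≤ exitBound := by
  set A : ℕ → Set Ω := fun k => {ω | ∀ j < k, B ((j : ℝ≥0) + 1) ω - B j ω ∈ Set.Icc (-2 : ℝ) 2}
    with hA
  have hAm (k : ℕ) : NullMeasurableSet (A k) P := by
    have : A k = ⋂ j ∈ Set.Iio k, (fun ω => B ((j : ℝ≥0) + 1) ω - B j ω) ⁻¹'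
        Set.Icc (-2 : ℝ) 2 := by
      ext ω; simp [hA]
    rw [this]
    refine NullMeasurableSet.biInter (Set.to_countable _) fun j _ => ?_
    exact ((hB.aemeasurable _).sub (hB.aemeasurable _)).nullMeasurable measurableSet_Icc
  have hle : ∀ᵐ ω ∂P, T ω ≤ ∑' k, (A k).indicator 1 ω := by
    filter_upwards [hT] with ω hω
    -- If every increment is small the series is infinite, so this event needs no separate null-set
    -- argument.
    by_cases hall : ∀ k, ω ∈ A k
    · have : ∑' k, (A k).indicator (1 : Ω → ℝ≥0∞) ω = ∑' _ : ℕ, 1 :=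
        tsum_congr fun k => Set.indicator_of_mem (hall k) _
      rw [this, ENNReal.tsum_const_eq_top_of_ne_zero one_ne_zero]
      exact le_top
    · have hex : ∃ j : ℕ, B ((j : ℝ≥0) + 1) ω - B j ω ∉ Set.Icc (-2 : ℝ) 2 := by
        by_contra! hcon
        exact hall fun k j _ => hcon j
      classical
      have hj := Nat.find_spec hex
      have hmin : ∀ i < Nat.find hex, B ((i : ℝ≥0) + 1) ω - B i ω ∈ Set.Icc (-2 : ℝ) 2 :=
        fun i hi => not_not.1 (Nat.find_min hex hi)
      set j := Nat.find hex
      -- An increment outside `[-2, 2]` forces one of its two endpoints outside `[-1, 1]`.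
      have hTj : T ω ≤ ((j + 1 : ℕ) : ℝ≥0∞) := by
        by_cases h1 : 1 < |B j ω|
        · exact (hω j h1).trans (by exact_mod_cast j.le_succ)
        · refine hω (j + 1) ?_
          push Not at h1
          by_contra! h2
          push_cast at h2
          rw [abs_le] at h1 h2
          exact hj ⟨by linarith [h1.2, h2.1], by linarith [h1.1, h2.2]⟩
      refine hTj.trans ?_
      -- `A k` only constrains increments with index below `k`, so `ω` lies in the `j + 1` sets `A
      -- 0, ..., A j`.
      have hs : ∑ k ∈ Finset.range (j + 1), (A k).indicator (1 : Ω → ℝ≥0∞) ω = (j + 1 : ℕ) := by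
        rw [Finset.sum_congr rfl (g := fun _ => (1 : ℝ≥0∞))]
        · simp
        · intro k hk
          have hk' := Finset.mem_range.1 hk
          have hmem : ω ∈ A k := fun i hi => hmin i (by omega)
          exact Set.indicator_of_mem hmem _
      rw [← hs]
      exact ENNReal.sum_le_tsum _
  calc ∫⁻ ω, T ω ∂P ≤ ∫⁻ ω, ∑' k, (A k).indicator 1 ω ∂P := lintegral_mono_ae hle
    _ = ∑' k, ∫⁻ ω, (A k).indicator 1 ω ∂P :=
        lintegral_tsum fun k => (aemeasurable_indicator_const_iff 1).2 (hAm k)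
    _ = ∑' k, gaussianReal 0 1 (Set.Icc (-2) 2) ^ k := by
        refine tsum_congr fun k => ?_
        rw [lintegral_indicator_one₀ (hAm k), measure_forall_increment_mem hB k]
    _ = exitBound := ENNReal.tsum_geometric _

/-- The infimum of the times in a fixed dense sequence at which a path, recorded along that
sequence, lies outside `[-1/2, 1/2]`. -/
noncomputable def denseExit (w : ℕ → ℝ) : ℝ≥0∞ :=
  ⨅ (n : ℕ) (_ : 1 / 2 < |w n|), ((TopologicalSpace.denseSeq ℝ≥0 n : ℝ≥0) : ℝ≥0∞)

lemma measurable_denseExit : Measurable denseExit := by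
  classical
  refine Measurable.iInf fun n => ?_
  have : (fun w : ℕ → ℝ => ⨅ (_ : 1 / 2 < |w n|),
      ((TopologicalSpace.denseSeq ℝ≥0 n : ℝ≥0) : ℝ≥0∞)) =
      fun w => if 1 / 2 < |w n| then ((TopologicalSpace.denseSeq ℝ≥0 n : ℝ≥0) : ℝ≥0∞) else ⊤ := by
    ext w
    exact iInf_eq_if _
  rw [this]
  refine Measurable.ite ?_ measurable_const measurable_const
  exact measurableSet_lt measurable_const (by fun_prop)

/-- The gap between the levels `1 / 2` and `1` leaves an open set of times around `s`, which the
dense sequence meets arbitrarily close to `s`. -/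
lemma denseExit_le {w : ℝ≥0 → ℝ} (hw : Continuous w) {s : ℝ≥0} (hs : 1 ≤ |w s|) :
    denseExit (fun n => w (TopologicalSpace.denseSeq ℝ≥0 n)) ≤ s := by
  refine ENNReal.le_of_forall_pos_le_add fun ε hε _ => ?_
  have hopen : IsOpen ({u : ℝ≥0 | 1 / 2 < |w u|} ∩ Set.Iio (s + ε)) :=
    (isOpen_lt continuous_const (by fun_prop)).inter isOpen_Iio
  obtain ⟨n, hn⟩ := (TopologicalSpace.denseRange_denseSeq ℝ≥0).exists_mem_open hopen
    ⟨s, by show 1 / 2 < |w s|; linarith, by simpa using hε⟩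
  refine (iInf₂_le n hn.1).trans ?_
  exact_mod_cast (show TopologicalSpace.denseSeq ℝ≥0 n < s + ε from hn.2).le

lemma denseExit_pos {w : ℝ≥0 → ℝ} (hw : Continuous w) (h0 : w 0 = 0) :
    0 < denseExit (fun n => w (TopologicalSpace.denseSeq ℝ≥0 n)) := by
  have hmem : {u : ℝ≥0 | |w u| < 1 / 2} ∈ 𝓝 (0 : ℝ≥0) :=
    (isOpen_lt (by fun_prop) continuous_const).mem_nhds (by simp [h0])
  obtain ⟨δ, hδ, hball⟩ := NNReal.nhds_zero_basis.mem_iff.1 hmem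
  refine lt_of_lt_of_le (ENNReal.coe_pos.2 hδ) (le_iInf₂ fun n hn => ?_)
  by_contra! hlt
  have h1 : |w (TopologicalSpace.denseSeq ℝ≥0 n)| < 1 / 2 :=
    hball (show _ < δ by exact_mod_cast hlt)
  linarith

/-- `denseExit` depends on countably many coordinates, so its expectation is determined by the
finite-dimensional laws. This lets a rescaled Brownian motion replace the original one. -/
lemma IsPreBrownianReal.lintegral_denseExit_eq {B' : ℝ≥0 → Ω → ℝ} (hB : IsPreBrownianReal B P)
    (hB' : IsPreBrownianReal B' P) :
    ∫⁻ ω, denseExit (fun n => B (TopologicalSpace.denseSeq ℝ≥0 n) ω) ∂P =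
      ∫⁻ ω, denseExit (fun n => B' (TopologicalSpace.denseSeq ℝ≥0 n) ω) ∂P := by
  have := hB.isGaussianProcess.isProbabilityMeasure
  set q := TopologicalSpace.denseSeq ℝ≥0
  have hm {C : ℝ≥0 → Ω → ℝ} (hC : IsPreBrownianReal C P) :
      AEMeasurable (fun ω (n : ℕ) => C (q n) ω) P :=
    aemeasurable_pi_lambda _ fun n => hC.aemeasurable _
  have hmap : P.map (fun ω (n : ℕ) => B (q n) ω) = P.map (fun ω (n : ℕ) => B' (q n) ω) := by
    refine (map_eq_iff_forall_finset_map_restrict_eq (X := fun n => B (q n))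
      (Y := fun n => B' (q n)) (hm hB) (hm hB')).2 fun I => ?_
    classical
    -- The sequence may repeat values, so the marginal over indices is pulled back from the one over
    -- distinct times.
    let J : Finset ℝ≥0 := I.image q
    let g : (J → ℝ) → (I → ℝ) := fun x i => x ⟨q i, Finset.mem_image_of_mem q i.2⟩
    have hg : Measurable g := measurable_pi_lambda _ fun i => measurable_pi_apply _
    have hC {C : ℝ≥0 → Ω → ℝ} (hC : IsPreBrownianReal C P) :
        P.map (fun ω => I.restrict (fun n => C (q n) ω)) =
          (BrownianReal.projectiveFamily J).map g := by
      rw [← (hC.hasLaw J).map_eq,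
        AEMeasurable.map_map_of_aemeasurable hg.aemeasurable (hC.hasLaw J).aemeasurable]
      rfl
    rw [hC hB, hC hB']
  rw [← lintegral_map' measurable_denseExit.aemeasurable (hm hB), hmap,
    lintegral_map' measurable_denseExit.aemeasurable (hm hB')]

lemma IsBrownianReal.lintegral_denseExit_pos (hB : IsBrownianReal B P) :
    0 < ∫⁻ ω, denseExit (fun n => B (TopologicalSpace.denseSeq ℝ≥0 n) ω) ∂P := by
  have := hB.isGaussianProcess.isProbabilityMeasure
  have hm : AEMeasurable
      (fun ω => denseExit (fun n => B (TopologicalSpace.denseSeq ℝ≥0 n) ω)) P :=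
    measurable_denseExit.comp_aemeasurable (aemeasurable_pi_lambda _ fun n => hB.aemeasurable _)
  rw [pos_iff_ne_zero, Ne, lintegral_eq_zero_iff' hm]
  intro h0
  have hfalse : ∀ᵐ ω ∂P, False := by
    filter_upwards [h0, hB.cont, hB.eval_zero_ae_eq_zero] with ω h1 h2 h3
    exact (denseExit_pos h2 h3).ne' h1
  simp at hfalse
  exact NeZero.ne P hfalse

end BrownianExit

/-! ### Expected exit times on the graph, by Brownian scaling. -/

section GraphExit

variable {X Ω : Type*} [MetricSpace X] {mΩ : MeasurableSpace Ω} {P : Measure Ω}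
  {W : ℝ≥0 → Ω → ℝ} {f : ℝ → X} {t r : ℝ}

lemma dist_toFunGraph (f : ℝ → X) (t u : ℝ) :
    dist (toFunGraph f u) (toFunGraph f t) = max |u - t| (dist (f u) (f t)) := rfl

lemma toFunGraph_mem_ball {u : ℝ} :
    toFunGraph f u ∈ Metric.ball (toFunGraph f t) r ↔ |u - t| < r ∧ dist (f u) (f t) < r := by
  rw [Metric.mem_ball, dist_toFunGraph, max_lt_iff]

/-- If the graph leaves the ball within distance `H` on both sides of `t`, the expected exit time
is at most of order `H ^ 2`. -/
lemma lintegral_exitTime_le (hW : IsWienerFrom t W P) {H u₁ u₂ : ℝ} (hH : 0 < H)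
    (hu₁ : u₁ ∈ Set.Icc (t - H) t) (hu₂ : u₂ ∈ Set.Icc t (t + H))
    (h₁ : toFunGraph f u₁ ∉ Metric.ball (toFunGraph f t) r)
    (h₂ : toFunGraph f u₂ ∉ Metric.ball (toFunGraph f t) r) :
    ∫⁻ ω, exitTime (fun s ω => toFunGraph f (W s ω)) (toFunGraph f t) r ω ∂P ≤
      exitBound * ENNReal.ofReal (H ^ 2) := by
  lift H to ℝ≥0 using hH.le
  have hH' : H ≠ 0 := by rintro rfl; simp at hH
  have hc : H ^ 2 ≠ 0 := pow_ne_zero 2 hH'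
  have hB := IsBrownianReal.smul hW hc
  have hcE : ((H ^ 2 : ℝ≥0) : ℝ≥0∞) ≠ 0 := by exact_mod_cast hc
  have key := lintegral_le_exitBound hB.toIsPreBrownianReal
    (T := fun ω => exitTime (fun s ω => toFunGraph f (W s ω)) (toFunGraph f t) r ω /
      ((H ^ 2 : ℝ≥0) : ℝ≥0∞)) ?_
  · simp only [div_eq_mul_inv] at key
    rw [lintegral_mul_const' _ _ (ENNReal.inv_ne_top.2 hcE), ← div_eq_mul_inv,
      ENNReal.div_le_iff hcE ENNReal.coe_ne_top] at key
    refine key.trans_eq ?_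
    rw [show ((H : ℝ) ^ 2) = ((H ^ 2 : ℝ≥0) : ℝ) by push_cast; rfl, ENNReal.ofReal_coe_nnreal]
  · filter_upwards [hW.cont, hW.eval_zero_ae_eq_zero] with ω hcont h0 n hn
    have hcont' : Continuous fun s => W s ω := by
      simpa using hcont.add_const t
    have h0' : W 0 ω = t := by linarith
    have hsqrt : √((H ^ 2 : ℝ≥0) : ℝ) = H := by
      push_cast
      exact Real.sqrt_sq H.2
    rw [hsqrt, abs_mul, abs_inv, abs_of_pos hH, lt_inv_mul_iff₀ hH, mul_one] at hn
    rw [ENNReal.div_le_iff hcE ENNReal.coe_ne_top]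
    set s : ℝ≥0 := H ^ 2 * n with hs
    -- At time `s` the path is more than `H` away from `t`, so it has already passed through `u₁` or
    -- `u₂`, depending on the side.
    have hivt : Set.uIcc (W 0 ω) (W s ω) ⊆ (fun s => W s ω) '' Set.Icc 0 s :=
      by
        rw [← Set.uIcc_of_le (zero_le (a := s))]
        exact intermediate_value_uIcc hcont'.continuousOn
    have hhit : ∃ s' ≤ s, toFunGraph f (W s' ω) ∉ Metric.ball (toFunGraph f t) r := by
      rw [h0'] at hivt
      rcases lt_abs.1 hn with h | h
      · obtain ⟨s', hs', he⟩ := hivt (Set.mem_uIcc_of_le hu₂.1 (by linarith [hu₂.2]))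
        simp only at he
        exact ⟨s', hs'.2, by rwa [he]⟩
      · obtain ⟨s', hs', he⟩ := hivt (Set.mem_uIcc_of_ge (by linarith [hu₁.1]) hu₁.2)
        simp only at he
        exact ⟨s', hs'.2, by rwa [he]⟩
    obtain ⟨s', hs's, hs'⟩ := hhit
    refine (iInf₂_le s' hs').trans ?_
    calc (s' : ℝ≥0∞) ≤ s := by exact_mod_cast hs's
      _ = n * ((H ^ 2 : ℝ≥0) : ℝ≥0∞) := by rw [hs]; push_cast; ring

/-- If the graph stays in the ball up to distance `h` from `t`, the expected exit time is at least
of order `h ^ 2`. -/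
lemma exists_le_lintegral_exitTime (hW : IsWienerFrom t W P) :
    ∃ c : ℝ, 0 < c ∧ ∀ (f : ℝ → X) (r h : ℝ), 0 < h →
      (∀ u, |u - t| < h → toFunGraph f u ∈ Metric.ball (toFunGraph f t) r) →
      ENNReal.ofReal (c * h ^ 2) ≤
        ∫⁻ ω, exitTime (fun s ω => toFunGraph f (W s ω)) (toFunGraph f t) r ω ∂P := by
  -- The constant comes from the unscaled process, hence does not depend on `f`, `r` or `h`.
  obtain ⟨c, hc0, hc⟩ := ENNReal.lt_iff_exists_nnreal_btwn.1
    (IsBrownianReal.lintegral_denseExit_pos hW)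
  refine ⟨c, by exact_mod_cast hc0, fun f r h hh hball => ?_⟩
  lift h to ℝ≥0 using hh.le
  have hh' : h ≠ 0 := by rintro rfl; simp at hh
  have h2 : h ^ 2 ≠ 0 := pow_ne_zero 2 hh'
  have hB := IsBrownianReal.smul hW h2
  have hcE : ((h ^ 2 : ℝ≥0) : ℝ≥0∞) ≠ 0 := by exact_mod_cast h2
  rw [IsPreBrownianReal.lintegral_denseExit_eq hW.toIsPreBrownianReal
    hB.toIsPreBrownianReal] at hc
  have hle : ∀ᵐ ω ∂P, ((h ^ 2 : ℝ≥0) : ℝ≥0∞) * denseExit (fun n =>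
      (√((h ^ 2 : ℝ≥0) : ℝ))⁻¹ * (W (h ^ 2 * TopologicalSpace.denseSeq ℝ≥0 n) ω - t)) ≤
      exitTime (fun s ω => toFunGraph f (W s ω)) (toFunGraph f t) r ω := by
    filter_upwards [hB.cont] with ω hcont
    refine le_iInf₂ fun s hs => ?_
    have hsqrt : √((h ^ 2 : ℝ≥0) : ℝ) = h := by
      push_cast
      exact Real.sqrt_sq h.2
    have hs' : (h : ℝ) ≤ |W s ω - t| := by
      by_contra! hlt
      exact hs (hball _ hlt)
    have hmul : h ^ 2 * (s / h ^ 2) = s := mul_div_cancel₀ s h2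
    have hd := denseExit_le hcont (s := s / h ^ 2) (by
      rw [hmul, hsqrt, abs_mul, abs_inv, abs_of_pos hh, le_inv_mul_iff₀ hh, mul_one]
      exact hs')
    calc _ ≤ ((h ^ 2 : ℝ≥0) : ℝ≥0∞) * ((s / h ^ 2 : ℝ≥0) : ℝ≥0∞) := by gcongr
      _ = s := by rw [← ENNReal.coe_mul, hmul]
  refine le_trans ?_ (lintegral_mono_ae hle)
  rw [lintegral_const_mul' _ _ ENNReal.coe_ne_top]
  calc ENNReal.ofReal (c * (h : ℝ) ^ 2) = ((h ^ 2 : ℝ≥0) : ℝ≥0∞) * c := by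
        rw [show ((c : ℝ) * (h : ℝ) ^ 2) = ((h ^ 2 * c : ℝ≥0) : ℝ) by push_cast; ring,
          ENNReal.ofReal_coe_nnreal, ENNReal.coe_mul]
    _ ≤ _ := by gcongr

end GraphExit

/-! ### Rarity of one-sided jumps. -/

section OneSidedJumps

variable {X : Type*} [MetricSpace X]

/-- Points from which `g` oscillates by at most `r` up to distance `H` to the left, but moves by
more than `2 * r` within distance `l` to the right. -/
def oneSidedJumpSet (g : ℝ → X) (H l r : ℝ) : Set ℝ :=
  {t | (∀ v ∈ Set.Icc (t - H) t, dist (g t) (g v) ≤ r) ∧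
    ∃ u ∈ Set.Ioc t (t + l), 2 * r < dist (g t) (g u)}

/-- Were `t'` farther than `l` from `t`, both `t` and its jump target `u` would lie in the quiet
stretch left of `t'`, making `g t` and `g u` at most `2 * r` apart. -/
lemma sub_le_of_mem_oneSidedJumpSet {g : ℝ → X} {H l r t t' : ℝ}
    (ht : t ∈ oneSidedJumpSet g H l r) (ht' : t' ∈ oneSidedJumpSet g H l r)
    (hle : t ≤ t') (hH : t' - t ≤ H) : t' - t ≤ l := by
  obtain ⟨-, u, hu, hd⟩ := ht
  by_contra! hlt
  have h1 := ht'.1 t ⟨by linarith, hle⟩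
  have h2 := ht'.1 u ⟨by linarith [hu.1], by linarith [hu.2]⟩
  have h3 := dist_triangle_left (g t) (g u) (g t')
  linarith

/-- Each cell of length `H` meets the set in diameter at most `l`. Only subadditivity is used, so
measurability of the set plays no role. -/
lemma volume_oneSidedJumpSet_inter_le (g : ℝ → X) {H l r : ℝ} (a : ℝ) (n : ℕ) :
    volume (oneSidedJumpSet g H l r ∩ Set.Ico a (a + n * H)) ≤ n * ENNReal.ofReal l := by
  induction n with
  | zero => simp
  | succ n ih =>
    have hsub : oneSidedJumpSet g H l r ∩ Set.Ico a (a + (n + 1 : ℕ) * H) ⊆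
        (oneSidedJumpSet g H l r ∩ Set.Ico a (a + n * H)) ∪
          (oneSidedJumpSet g H l r ∩ Set.Ico (a + n * H) (a + n * H + H)) := by
      rintro x ⟨hx, hx1, hx2⟩
      push_cast at hx2
      by_cases h : x < a + n * H
      · exact Or.inl ⟨hx, hx1, h⟩
      · exact Or.inr ⟨hx, not_lt.1 h, by linarith⟩
    have hdiam : volume (oneSidedJumpSet g H l r ∩ Set.Ico (a + n * H) (a + n * H + H)) ≤
        ENNReal.ofReal l := by
      refine (Real.volume_le_diam _).trans (Metric.ediam_le fun x hx y hy => ?_)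
      rw [edist_dist]
      refine ENNReal.ofReal_le_ofReal ?_
      rw [Real.dist_eq]
      rcases le_total x y with h | h
      · rw [abs_sub_comm, abs_of_nonneg (sub_nonneg.2 h)]
        exact sub_le_of_mem_oneSidedJumpSet hx.1 hy.1 h (by linarith [hx.2.1, hy.2.2])
      · rw [abs_of_nonneg (sub_nonneg.2 h)]
        exact sub_le_of_mem_oneSidedJumpSet hy.1 hx.1 h (by linarith [hy.2.1, hx.2.2])
    calc _ ≤ _ := (measure_mono hsub).trans (measure_union_le _ _)
      _ ≤ n * ENNReal.ofReal l + ENNReal.ofReal l := add_le_add ih hdiam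
      _ = _ := by push_cast; ring

/-- If `b < b'`, almost every point lies in only finitely many of the one-sided jump sets with
`r = 2⁻ᵏ`, `H = r ^ b`, `l = r ^ b'`. -/
lemma ae_eventually_notMem_oneSidedJumpSet (g : ℝ → X) {b b' : ℝ} (hb : 0 < b) (hbb' : b < b') :
    ∀ᵐ t : ℝ, ∀ᶠ k : ℕ in atTop, t ∉ oneSidedJumpSet g (((1 / 2 : ℝ) ^ k) ^ b)
      (((1 / 2 : ℝ) ^ k) ^ b') ((1 / 2 : ℝ) ^ k) := by
  have key (N : ℕ) : ∀ᵐ t : ℝ, ∀ᶠ k : ℕ in atTop,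
      t ∉ oneSidedJumpSet g (((1 / 2 : ℝ) ^ k) ^ b) (((1 / 2 : ℝ) ^ k) ^ b') ((1 / 2 : ℝ) ^ k) ∩
        Set.Ico (-N : ℝ) N := by
    refine ae_eventually_notMem ?_
    have hbound (k : ℕ) : volume (oneSidedJumpSet g (((1 / 2 : ℝ) ^ k) ^ b)
        (((1 / 2 : ℝ) ^ k) ^ b') ((1 / 2 : ℝ) ^ k) ∩ Set.Ico (-N : ℝ) N) ≤
        ENNReal.ofReal ((2 * N + 1) * ((1 / 2 : ℝ) ^ (b' - b)) ^ k) := by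
      set r : ℝ := (1 / 2 : ℝ) ^ k with hr
      have hr0 : 0 < r := by positivity
      have hr1 : r ≤ 1 := pow_le_one₀ (by norm_num) (by norm_num)
      have hH : 0 < r ^ b := by positivity
      have hH1 : r ^ b ≤ 1 := Real.rpow_le_one hr0.le hr1 hb.le
      -- The number of cells of length `r ^ b` needed to cover `[-N, N)`.
      set n := ⌈2 * N / r ^ b⌉₊ with hn
      have h1 : 2 * N / r ^ b ≤ n := Nat.le_ceil _
      have h2 : (n : ℝ) < 2 * N / r ^ b + 1 := Nat.ceil_lt_add_one (by positivity)
      have h3 : (2 * N : ℝ) ≤ n * r ^ b := (div_le_iff₀ hH).1 h1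
      have h4 : (n : ℝ) * r ^ b ≤ 2 * N + 1 := by
        have : (n : ℝ) * r ^ b ≤ (2 * N / r ^ b + 1) * r ^ b := by gcongr
        rw [add_mul, div_mul_cancel₀ _ hH.ne'] at this
        linarith
      calc _ ≤ volume (oneSidedJumpSet g (r ^ b) (r ^ b') r ∩
              Set.Ico (-N : ℝ) (-N + n * r ^ b)) :=
            measure_mono (Set.inter_subset_inter_right _ (Set.Ico_subset_Ico_right (by linarith)))
        _ ≤ n * ENNReal.ofReal (r ^ b') := volume_oneSidedJumpSet_inter_le g _ n
        _ = ENNReal.ofReal (n * r ^ b') := by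
            rw [ENNReal.ofReal_mul (Nat.cast_nonneg n), ENNReal.ofReal_natCast]
        _ ≤ _ := by
            refine ENNReal.ofReal_le_ofReal ?_
            have h5 : r ^ b' = r ^ b * ((1 / 2 : ℝ) ^ (b' - b)) ^ k := by
              rw [← Real.rpow_natCast, ← Real.rpow_mul (by norm_num), mul_comm (b' - b),
                Real.rpow_mul (by norm_num), Real.rpow_natCast, ← hr, ← Real.rpow_add hr0]
              ring_nf
            rw [h5, ← mul_assoc]
            gcongr
    have hq : (1 / 2 : ℝ) ^ (b' - b) < 1 :=
      Real.rpow_lt_one (by norm_num) (by norm_num) (by linarith)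
    have hsum : Summable fun k : ℕ => (2 * N + 1 : ℝ) * ((1 / 2 : ℝ) ^ (b' - b)) ^ k :=
      (summable_geometric_of_lt_one (by positivity) hq).mul_left _
    exact ne_top_of_le_ne_top hsum.tsum_ofReal_ne_top (ENNReal.tsum_le_tsum hbound)
  filter_upwards [ae_all_iff.2 key] with t ht
  obtain ⟨N, hN⟩ := exists_nat_gt |t|
  filter_upwards [ht N] with k hk hmem
  exact hk ⟨hmem, by linarith [(abs_lt.1 hN).1], (abs_lt.1 hN).2⟩

end OneSidedJumps

/-! ### Passing from power bounds to logarithmic quotients. -/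

section LogQuotient

lemma le_log_div_log {E : ℝ≥0∞} {C r e : ℝ} (hC : 0 < C) (hr : 0 < r) (hr1 : r < 1)
    (hE : E ≤ ENNReal.ofReal (C * r ^ e)) :
    ((e + Real.log C / Real.log r : ℝ) : EReal) ≤
      ENNReal.log E / ((Real.log r : ℝ) : EReal) := by
  have hlog : Real.log r < 0 := Real.log_neg hr hr1
  have h1 := EReal.div_le_div_right_of_nonpos (c := ((Real.log r : ℝ) : EReal))
    (by exact_mod_cast hlog.le) (ENNReal.log_le_log hE)
  refine le_trans (le_of_eq ?_) h1
  rw [ENNReal.log_ofReal_of_pos (by positivity), ← EReal.coe_div, Real.log_mul hC.ne' (by positivity),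
    Real.log_rpow hr]
  congr 1
  field_simp [hlog.ne]
  ring

lemma log_div_log_le {E : ℝ≥0∞} {C r e : ℝ} (hC : 0 < C) (hr : 0 < r) (hr1 : r < 1)
    (hE : ENNReal.ofReal (C * r ^ e) ≤ E) :
    ENNReal.log E / ((Real.log r : ℝ) : EReal) ≤
      ((e + Real.log C / Real.log r : ℝ) : EReal) := by
  have hlog : Real.log r < 0 := Real.log_neg hr hr1
  have h1 := EReal.div_le_div_right_of_nonpos (c := ((Real.log r : ℝ) : EReal))
    (by exact_mod_cast hlog.le) (ENNReal.log_le_log hE)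
  refine h1.trans (le_of_eq ?_)
  rw [ENNReal.log_ofReal_of_pos (by positivity), ← EReal.coe_div, Real.log_mul hC.ne' (by positivity),
    Real.log_rpow hr]
  congr 1
  field_simp [hlog.ne]
  ring

lemma tendsto_add_log_div_log (C e : ℝ) :
    Tendsto (fun r : ℝ => ((e + Real.log C / Real.log r : ℝ) : EReal)) (𝓝[>] 0)
      (𝓝 (e : EReal)) := by
  refine (continuous_coe_real_ereal.tendsto e).comp ?_
  have h : Tendsto (fun r : ℝ => Real.log C / Real.log r) (𝓝[>] 0) (𝓝 0) :=
    Real.tendsto_log_nhdsGT_zero.const_div_atBot _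
  simpa using h.const_add e

end LogQuotient

/-! ### Two-sided oscillation from Hölder regularity. -/

section HolderRegular

variable {X : Type*} [MetricSpace X] {f : ℝ → X} {α t : ℝ}

lemma LocallyHolderAt.continuousAt {β : ℝ} (hβ : 0 < β) (h : LocallyHolderAt β f t) :
    ContinuousAt f t := by
  obtain ⟨U, hU, htU, C, hC, hd⟩ := h
  rw [ContinuousAt, tendsto_iff_dist_tendsto_zero]
  have hlim : Tendsto (fun u => C * dist t u ^ β) (𝓝 t) (𝓝 0) := by
    have : Continuous fun u => C * dist t u ^ β :=
      continuous_const.mul ((continuous_const.dist continuous_id).rpow_const fun _ => Or.inr hβ.le)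
    simpa [Real.zero_rpow hβ.ne'] using this.tendsto t
  refine squeeze_zero' (Eventually.of_forall fun _ => dist_nonneg) ?_ hlim
  filter_upwards [hU.mem_nhds htU] with u hu
  rw [dist_comm]
  exact hd u hu

lemma LocallyHolderRegularAt.continuousAt (hα : 0 < α) (h : LocallyHolderRegularAt α f t) :
    ContinuousAt f t := by
  obtain ⟨β, ⟨hβ, hβf⟩, -⟩ := (lt_isLUB_iff h).1 hα
  exact hβf.continuousAt hβ.1

/-- Failure of `β`-Hölder continuity at `t` yields arbitrarily close points with large
difference quotient of order `β`. -/
lemma exists_lt_dist_of_not_locallyHolderAt {β : ℝ} (h : ¬ LocallyHolderAt β f t) {C δ : ℝ}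
    (hC : 0 < C) (hδ : 0 < δ) : ∃ u, |t - u| < δ ∧ C * |t - u| ^ β < dist (f t) (f u) := by
  by_contra! hcon
  refine h ⟨Metric.ball t δ, Metric.isOpen_ball, Metric.mem_ball_self hδ, C, hC, fun u hu => ?_⟩
  rw [Metric.mem_ball, dist_comm, Real.dist_eq] at hu
  exact hcon u hu

/-- At a point that is not `1 / b'`-Hölder and lies, for `f` and for its reflection, in only
finitely many one-sided jump sets, there are arbitrarily small dyadic radii `r` such that `f`
moves by at least `r` within distance `r ^ b` on both sides. -/
lemma frequently_exists_two_sided {b b' : ℝ} (hb : 0 < b) (hbb' : b < b') (hcont : ContinuousAt f t)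
    (hf : ¬ LocallyHolderAt b'⁻¹ f t)
    (hright : ∀ᶠ k : ℕ in atTop, t ∉ oneSidedJumpSet f (((1 / 2 : ℝ) ^ k) ^ b)
      (((1 / 2 : ℝ) ^ k) ^ b') ((1 / 2 : ℝ) ^ k))
    (hleft : ∀ᶠ k : ℕ in atTop, -t ∉ oneSidedJumpSet (fun s => f (-s)) (((1 / 2 : ℝ) ^ k) ^ b)
      (((1 / 2 : ℝ) ^ k) ^ b') ((1 / 2 : ℝ) ^ k)) :
    ∃ᶠ r in 𝓝[>] (0 : ℝ), ∃ u₁ ∈ Set.Icc (t - r ^ b) t, ∃ u₂ ∈ Set.Icc t (t + r ^ b),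
      r ≤ dist (f u₁) (f t) ∧ r ≤ dist (f u₂) (f t) := by
  have hb' : 0 < b' := hb.trans hbb'
  have hpow : Tendsto (fun k : ℕ => (1 / 2 : ℝ) ^ k) atTop (𝓝[>] 0) :=
    tendsto_nhdsWithin_iff.2 ⟨tendsto_pow_atTop_nhds_zero_of_lt_one (by norm_num) (by norm_num),
      Eventually.of_forall fun k => by simp⟩
  refine hpow.frequently (frequently_atTop.2 fun K => ?_)
  obtain ⟨K', hK'⟩ := eventually_atTop.1 (hright.and (hleft.and (eventually_ge_atTop K)))
  obtain ⟨δ, hδ, hδf⟩ := Metric.continuousAt_iff.1 hcont ((1 / 2 : ℝ) ^ K') (by positivity)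
  -- The factor 4 matches the choice of `r = (1 / 2) ^ (m + 2)` below: `2 * r < D ≤ 4 * r`, so `u`
  -- is a jump target at scale `r` and `|t - u| ^ b'⁻¹ < D / 4 ≤ r`.
  obtain ⟨u, huδ, hu⟩ := exists_lt_dist_of_not_locallyHolderAt hf (C := 4) (by norm_num) hδ
  have hut : dist (f u) (f t) < (1 / 2 : ℝ) ^ K' := hδf (by rwa [dist_comm, Real.dist_eq])
  set D := dist (f t) (f u) with hD
  have hDlt : D < (1 / 2 : ℝ) ^ K' := by rwa [hD, dist_comm]
  have hD0 : 0 < D := lt_of_le_of_lt (by positivity) hu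
  have hD1 : D ≤ 1 := hDlt.le.trans (pow_le_one₀ (by norm_num) (by norm_num))
  obtain ⟨m, hm1, hm2⟩ := exists_nat_pow_near_of_lt_one hD0 hD1 (by norm_num : (0 : ℝ) < 1 / 2)
    (by norm_num)
  have hmK : K' ≤ m := by
    by_contra! hlt
    have : (1 / 2 : ℝ) ^ K' ≤ (1 / 2 : ℝ) ^ (m + 1) :=
      pow_le_pow_of_le_one (by norm_num) (by norm_num) hlt
    linarith
  obtain ⟨hkr, hkl, hkK⟩ := hK' (m + 2) (by omega)
  refine ⟨m + 2, hkK, ?_⟩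
  set r : ℝ := (1 / 2 : ℝ) ^ (m + 2) with hr
  have hr0 : 0 < r := by positivity
  have hr1 : r ≤ 1 := pow_le_one₀ (by norm_num) (by norm_num)
  have h2r : 2 * r < D := by
    have : 2 * r = (1 / 2 : ℝ) ^ (m + 1) := by rw [hr]; ring
    linarith
  have h4r : D ≤ 4 * r := by
    have : 4 * r = (1 / 2 : ℝ) ^ m := by rw [hr]; ring
    linarith
  have hdist : |t - u| ≤ r ^ b' := by
    have h1 : |t - u| ^ b'⁻¹ ≤ r := by linarith
    calc |t - u| = (|t - u| ^ b'⁻¹) ^ b' := by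
          rw [← Real.rpow_mul (abs_nonneg _), inv_mul_cancel₀ hb'.ne', Real.rpow_one]
      _ ≤ r ^ b' := Real.rpow_le_rpow (by positivity) h1 hb'.le
  have hbr : r ^ b' ≤ r ^ b := Real.rpow_le_rpow_of_exponent_ge hr0 hr1 hbb'.le
  have hne : u ≠ t := by
    rintro rfl
    simp [hD] at hD0
  rcases lt_or_gt_of_ne hne with hlt | hgt
  · rw [abs_of_pos (by linarith)] at hdist
    -- A quiet right side together with the jump to `u` on the left would put `-t` in the jump set
    -- of the reflected function.
    have hex : ∃ v ∈ Set.Icc t (t + r ^ b), r < dist (f t) (f v) := by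
      by_contra! hcon
      refine hkl ⟨fun v hv => ?_, -u, ⟨by linarith, by linarith⟩, by simpa using h2r⟩
      simpa using hcon (-v) ⟨by linarith [hv.2], by linarith [hv.1]⟩
    obtain ⟨v, hv, hvd⟩ := hex
    exact ⟨u, ⟨by linarith, hlt.le⟩, v, hv, by rw [dist_comm, ← hD]; linarith,
      by rw [dist_comm]; exact hvd.le⟩
  · rw [abs_sub_comm, abs_of_pos (by linarith)] at hdist
    have hex : ∃ v ∈ Set.Icc (t - r ^ b) t, r < dist (f t) (f v) := by
      by_contra! hcon
      exact hkr ⟨hcon, u, ⟨hgt, by linarith⟩, h2r⟩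
    obtain ⟨v, hv, hvd⟩ := hex
    exact ⟨v, hv, u, ⟨hgt.le, by linarith⟩, by rw [dist_comm]; exact hvd.le,
      by rw [dist_comm, ← hD]; linarith⟩

end HolderRegular

/-! ### Bounds for the upper local walk dimension. -/

section LocalWalkDim

variable {X Ω : Type*} [MetricSpace X] {mΩ : MeasurableSpace Ω} {P : Measure Ω}
  {W : ℝ≥0 → Ω → ℝ} {f : ℝ → X} {α t : ℝ}

/-- If `f` is Hölder continuous at `t` with exponents arbitrarily close to `α`, the upper local
walk dimension is at most `2 / α`. -/
lemma upperLocalWalkDim_le (hα : α ∈ Set.Ioc (0 : ℝ) 1) (hf : LocallyHolderRegularAt α f t)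
    (hW : IsWienerFrom t W P) :
    upperLocalWalkDim P (fun s ω => toFunGraph f (W s ω)) (toFunGraph f t) ≤
      ((2 / α : ℝ) : EReal) := by
  refine EReal.le_of_forall_lt_iff_le.1 fun y hy => ?_
  have hy' : 2 / α < y := by exact_mod_cast hy
  set e := y / 2 with he
  have hαe : 1 / α < e := by
    rw [he, lt_div_iff₀ two_pos]
    calc 1 / α * 2 = 2 / α := by ring
      _ < y := hy'
  have he1 : 1 < e := lt_of_le_of_lt ((one_le_div hα.1).2 hα.2) hαe
  have he0 : 0 < e := one_pos.trans he1
  have heα : e⁻¹ < α := by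
    rw [inv_lt_comm₀ he0 hα.1]
    simpa using hαe
  obtain ⟨β, ⟨hβ, U, hU, htU, C, hC, hd⟩, hβe⟩ := (lt_isLUB_iff hf).1 heα
  have heβ : 0 < e * β - 1 := by
    have := (inv_lt_iff_one_lt_mul₀ he0).1 hβe
    linarith
  obtain ⟨c, hc, hlow⟩ := exists_le_lintegral_exitTime (X := X) hW
  obtain ⟨δ, hδ, hδU⟩ := Metric.isOpen_iff.1 hU t htU
  have hsmall : ∀ᶠ r in 𝓝[>] (0 : ℝ), C * r ^ (e * β - 1) < 1 := by
    have hcts : Continuous fun r : ℝ => C * r ^ (e * β - 1) :=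
      continuous_const.mul (continuous_id.rpow_const fun _ => Or.inr heβ.le)
    have hlim := hcts.tendsto 0
    simp only [Real.zero_rpow heβ.ne', mul_zero] at hlim
    exact (hlim.mono_left nhdsWithin_le_nhds).eventually_lt_const one_pos
  have hev : ∀ᶠ r in 𝓝[>] (0 : ℝ), ENNReal.log (∫⁻ ω, exitTime
      (fun s ω => toFunGraph f (W s ω)) (toFunGraph f t) r ω ∂P) / ((Real.log r : ℝ) : EReal) ≤
      ((y + Real.log c / Real.log r : ℝ) : EReal) := by
    filter_upwards [hsmall, Ioo_mem_nhdsGT (show (0 : ℝ) < min 1 δ by positivity)] with r hr1 hr2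
    have hr0 : 0 < r := hr2.1
    have hrlt : r < 1 := hr2.2.trans_le (min_le_left _ _)
    have hrδ : r < δ := hr2.2.trans_le (min_le_right _ _)
    have her : r ^ e < r := by
      simpa using Real.rpow_lt_rpow_of_exponent_gt hr0 hrlt he1
    refine log_div_log_le hc hr0 hrlt ?_
    have hpow : r ^ y = (r ^ e) ^ 2 := by
      rw [← Real.rpow_natCast, ← Real.rpow_mul hr0.le, he]
      congr 1
      push_cast
      ring
    rw [hpow]
    refine hlow f r (r ^ e) (by positivity) fun u hu => toFunGraph_mem_ball.2 ⟨hu.trans her, ?_⟩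
    have huU : u ∈ U := hδU (by rw [Metric.mem_ball, Real.dist_eq]; linarith)
    rw [dist_comm]
    calc dist (f t) (f u) ≤ C * dist t u ^ β := hd u huU
      _ ≤ C * (r ^ e) ^ β := by
          gcongr
          · exact hβ.1.le
          · rw [dist_comm, Real.dist_eq]; exact hu.le
      _ = C * r ^ (e * β - 1) * r := by
          rw [← Real.rpow_mul hr0.le, mul_assoc, ← Real.rpow_add_one hr0.ne']
          ring_nf
      _ < 1 * r := by gcongr
      _ = r := one_mul r
  calc _ ≤ limsup (fun r : ℝ => ((y + Real.log c / Real.log r : ℝ) : EReal)) (𝓝[>] 0) :=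
        limsup_le_limsup hev
    _ = y := (tendsto_add_log_div_log c y).limsup_eq

/-- If there are arbitrarily small radii `r` such that the graph leaves the ball of radius `r`
within distance `r ^ b` on both sides, the upper local walk dimension is at least `2 * b`. -/
lemma le_upperLocalWalkDim (hW : IsWienerFrom t W P) {b : ℝ}
    (h : ∃ᶠ r in 𝓝[>] (0 : ℝ), ∃ u₁ ∈ Set.Icc (t - r ^ b) t, ∃ u₂ ∈ Set.Icc t (t + r ^ b),
      toFunGraph f u₁ ∉ Metric.ball (toFunGraph f t) r ∧
      toFunGraph f u₂ ∉ Metric.ball (toFunGraph f t) r) :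
    ((2 * b : ℝ) : EReal) ≤
      upperLocalWalkDim P (fun s ω => toFunGraph f (W s ω)) (toFunGraph f t) := by
  have hC : 0 < exitBound.toReal := ENNReal.toReal_pos exitBound_ne_zero exitBound_ne_top
  refine le_of_forall_lt_imp_le_of_dense fun z hz => ?_
  refine le_limsup_of_frequently_le' ?_
  have hev := (tendsto_add_log_div_log exitBound.toReal (2 * b)).eventually_const_lt hz
  refine (h.and_eventually (hev.and (Ioo_mem_nhdsGT one_pos))).mono ?_
  rintro r ⟨⟨u₁, hu₁, u₂, hu₂, h₁, h₂⟩, hzr, hr0, hr1⟩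
  refine hzr.le.trans (le_log_div_log hC hr0 hr1 ?_)
  have hpow : r ^ (2 * b) = (r ^ b) ^ 2 := by
    rw [← Real.rpow_natCast, ← Real.rpow_mul hr0.le]
    congr 1
    push_cast
    ring
  rw [ENNReal.ofReal_mul hC.le, ENNReal.ofReal_toReal exitBound_ne_top, hpow]
  exact lintegral_exitTime_le hW (Real.rpow_pos_of_pos hr0 b) hu₁ hu₂ h₁ h₂

/-- Projection inverts the graph map continuously. This turns almost-everywhere statements on the
graph into ones on the line, with no measurability condition on the property. -/
lemma measurableEmbedding_toFunGraph (hf : Continuous f) :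
    MeasurableEmbedding (toFunGraph f) := by
  have hcont : Continuous (toFunGraph f) :=
    Continuous.subtype_mk (continuous_id.prodMk hf) _
  have hproj : Continuous (FunGraph.proj (f := f)) :=
    continuous_fst.comp continuous_subtype_val
  have hinv : Function.RightInverse (FunGraph.proj (f := f)) (toFunGraph f) :=
    fun p => Subtype.ext (Prod.ext rfl p.2.symm)
  let e : ℝ ≃ₜ FunGraph f :=
    { toFun := toFunGraph f
      invFun := FunGraph.proj
      left_inv := fun _ => rfl
      right_inv := hinv
      continuous_toFun := hcont
      continuous_invFun := hproj }
  exact e.toMeasurableEquiv.measurableEmbedding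

end LocalWalkDim

/-! ### The walk dimension of the graph. -/

theorem mainTheorem7 {X Ω : Type*} [MetricSpace X] [MeasurableSpace Ω]
    (α : ℝ) (hα : α ∈ Set.Ioc (0 : ℝ) 1)
    (f : ℝ → X) (hf : ∀ t : ℝ, LocallyHolderRegularAt α f t)
    (P : ℝ → Measure Ω) (W : ℝ → ℝ≥0 → Ω → ℝ) (hW : ∀ t : ℝ, IsWienerFrom t (W t) (P t)) :
    HasUpperWalkDim (funGraphMeasure f) (fun x => P x.proj)
      (fun x s ω => toFunGraph f (W x.proj s ω)) ((2 / α : ℝ) : EReal) := by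
  have hcont : Continuous f :=
    continuous_iff_continuousAt.2 fun t => (hf t).continuousAt hα.1
  rw [HasUpperWalkDim, funGraphMeasure, (measurableEmbedding_toFunGraph hcont).ae_map_iff]
  -- Rational exponents allow a single null set to serve all pairs.
  have hright : ∀ᵐ t : ℝ, ∀ b b' : ℚ, 0 < b → b < b' → ∀ᶠ k : ℕ in atTop,
      t ∉ oneSidedJumpSet f (((1 / 2 : ℝ) ^ k) ^ (b : ℝ))
        (((1 / 2 : ℝ) ^ k) ^ (b' : ℝ)) ((1 / 2 : ℝ) ^ k) := by
    simp only [ae_all_iff, eventually_imp_distrib_left]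
    exact fun b b' hb hbb' => ae_eventually_notMem_oneSidedJumpSet f (by exact_mod_cast hb)
      (by exact_mod_cast hbb')
  have hleft : ∀ᵐ t : ℝ, ∀ b b' : ℚ, 0 < b → b < b' → ∀ᶠ k : ℕ in atTop,
      -t ∉ oneSidedJumpSet (fun s => f (-s)) (((1 / 2 : ℝ) ^ k) ^ (b : ℝ))
        (((1 / 2 : ℝ) ^ k) ^ (b' : ℝ)) ((1 / 2 : ℝ) ^ k) := by
    simp only [ae_all_iff, eventually_imp_distrib_left]
    exact fun b b' hb hbb' => (Measure.measurePreserving_neg volume).quasiMeasurePreserving.ae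
      (ae_eventually_notMem_oneSidedJumpSet (fun s => f (-s)) (by exact_mod_cast hb)
        (by exact_mod_cast hbb'))
  filter_upwards [hright, hleft] with t htr htl
  refine le_antisymm (upperLocalWalkDim_le hα (hf t) (hW t)) ?_
  -- For `α = 1` the first coordinate alone forces exit at distance `r` on both sides.
  rcases hα.2.eq_or_lt with rfl | hα1
  · have h := le_upperLocalWalkDim (f := f) (b := 1) (hW t) ?_
    · rw [div_one]
      rwa [mul_one] at h
    · refine Eventually.frequently ?_
      filter_upwards [self_mem_nhdsWithin] with r (hr : 0 < r)
      refine ⟨t - r, by simp [hr.le], t + r, by simp [hr.le], ?_, ?_⟩ <;>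
      · rw [toFunGraph_mem_ball]
        rintro ⟨h, -⟩
        simp [abs_of_pos hr] at h
  · refine le_of_forall_lt_imp_le_of_dense fun y hy => ?_
    obtain ⟨z, hyz, hz⟩ := EReal.lt_iff_exists_real_btwn.1 hy
    have hz' : z < 2 / α := by exact_mod_cast hz
    -- Keeping the exponents above 1 puts `b'⁻¹` in `(0, 1]`, the range over which `α` is the
    -- supremum.
    have hzα : max (z / 2) 1 < 1 / α := by
      refine max_lt ?_ ((one_lt_div hα.1).2 hα1)
      rw [div_lt_iff₀ two_pos]
      calc z < 2 / α := hz'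
        _ = 1 / α * 2 := by ring
    obtain ⟨b, hb1, hb2⟩ := exists_rat_btwn hzα
    obtain ⟨b', hb'1, hb'2⟩ := exists_rat_btwn hb2
    have hb : (1 : ℝ) < b := (le_max_right _ _).trans_lt hb1
    have hzb : z / 2 < b := (le_max_left _ _).trans_lt hb1
    have hb' : (1 : ℝ) < b' := hb.trans hb'1
    have hb0 : 0 < b := by exact_mod_cast one_pos.trans hb
    have hnot : ¬ LocallyHolderAt ((b' : ℝ)⁻¹) f t := by
      intro hH
      have hle : (b' : ℝ)⁻¹ ≤ α :=
        (hf t).1 ⟨⟨by positivity, inv_le_one_of_one_le₀ hb'.le⟩, hH⟩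
      rw [one_div, lt_inv_comm₀ (by positivity) hα.1] at hb'2
      linarith
    refine hyz.le.trans (le_trans ?_ (le_upperLocalWalkDim (f := f) (b := b) (hW t) ?_))
    · exact_mod_cast (show z ≤ 2 * (b : ℝ) by linarith)
    · refine (frequently_exists_two_sided (by positivity) hb'1 hcont.continuousAt hnot
        (htr b b' hb0 (by exact_mod_cast hb'1)) (htl b b' hb0 (by exact_mod_cast hb'1))).mono ?_
      rintro r ⟨u₁, hu₁, u₂, hu₂, h₁, h₂⟩
      exact ⟨u₁, hu₁, u₂, hu₂, fun h => h₁.not_gt (toFunGraph_mem_ball.1 h).2,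
        fun h => h₂.not_gt (toFunGraph_mem_ball.1 h).2⟩
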